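/- Binary sequences are elements of $\Xi=\{0,1\}^{\mathbb N}$, $\mathbb N=\{1,2,\dots\}$, with the product topology. For $b\in\{0,1\}$ and $i\in\mathbb N$ let $\triangle^{b}_i:\Xi\to\Xi$ be the operator that deletes the $i$-th digit of $\xi$ (shifting all later digits one place to the left) if $\xi_i=b$, and leaves $\xi$ unchanged otherwise. A pair $(\eta,\xi)\in\Xi\times\Xi$ is called compatible if there are sequences $(\eta^{(k)})_{k\ge1}$ and $(\xi^{(k)})_{k\ge1}$ in $\Xi$ that converge to the same limit in $\Xi$, where each $\eta^{(k)}$ is obtained from $\eta$ by finitely many applications of operators $\triangle^{1}_i$ and each $\xi^{(k)}$ is obtained from $\xi$ by finitely many applications of operators $\triangle^{0}_i$. For $p\in[0,1]$ let $\mathbb P_p$ be the product measure on $\Xi$ with $\mathbb P_p(\xi_i=1)=p$ for all $i$. Let $L\ge 2$ be an integer and $M=3(L+1)$. Let $\zeta(L)$ be the word whose $j$-th letter, $j\ge1$, is the integer $k\ge 0$ with $L^k\mid j$ and $L^{k+1}\nmid j$. Let $\eta(L)\in\Xi$ be the binary sequence obtained from $\zeta(L)$ by replacing each letter $k\ge1$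 by a run of $3M^{k-1}$ consecutive ones and each letter $0$ by a single zero, and concatenating these blocks in order. **Theorem.** If $L\ge 2$ is an integer and $0\le p<\dfrac{1}{576(L+1)^2}$, then $$\mathbb P_p\{\xi\in\Xi:\ (\eta(L),\xi)\text{ is compatible}\}>0 .$$ -/

import Mathlib

open MeasureTheory ProbabilityTheory Filter Topology

namespace BinaryCompat

/-! Semi-infinite binary sequences are functions `ℕ → Bool` with the product topology and the
product σ-algebra.  Indices start at `0`, so the entry `n` of a Lean sequence is the `(n+1)`-st
letter of the word. -/

/-- The annihilation operator at position `i` for the digit `b`: it deletes the digit at position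
`i` and shifts everything to its right by one unit to the left if that digit is `b`; otherwise it
does nothing. -/
def annihilate (b : Bool) (i : ℕ) (ξ : ℕ → Bool) : ℕ → Bool :=
  if ξ i = b then fun j => if i ≤ j then ξ (j + 1) else ξ j else ξ

/-- `Reaches b ξ ξ'`: the sequence `ξ'` is obtained from `ξ` by finitely many (possibly zero)
applications of the annihilation operators for the digit `b`. -/
def Reaches (b : Bool) : (ℕ → Bool) → (ℕ → Bool) → Prop :=
  Relation.ReflTransGen (fun α β => ∃ i, β = annihilate b i α)

/-- The ordered pair `(η, ξ)` is compatible: there are sequences of words, obtained by finitely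
many deletions of ones from `η` and of zeroes from `ξ` respectively, with a common limit in the
product topology. -/
def Compatible (η ξ : ℕ → Bool) : Prop :=
  ∃ (u v : ℕ → ℕ → Bool) (w : ℕ → Bool),
    (∀ k, Reaches true η (u k)) ∧ (∀ k, Reaches false ξ (v k)) ∧
      Tendsto u atTop (𝓝 w) ∧ Tendsto v atTop (𝓝 w)

/-- The product Bernoulli measure `ℙ_p` on binary sequences: the digits are independent and each
of them is `1` with probability `p`. -/
noncomputable def bernoulliProduct (p : unitInterval) : Measure (ℕ → Bool) :=
  Measure.infinitePi (fun _ : ℕ => bernoulliMeasure true false p)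

/-- The hierarchical word `ζ(L)`: the letter at (one-based) position `j` is the largest `k` with
`L ^ k ∣ j`. -/
noncomputable def hierWord (L : ℕ) (n : ℕ) : ℕ := multiplicity L (n + 1)

theorem hierWord_eq_iff {L : ℕ} (hL : 2 ≤ L) (n k : ℕ) :
    hierWord L n = k ↔ L ^ k ∣ n + 1 ∧ ¬ L ^ (k + 1) ∣ n + 1 := by
  have hf : FiniteMultiplicity L (n + 1) :=
    Nat.finiteMultiplicity_iff.2 ⟨by omega, by omega⟩
  exact hf.multiplicity_eq_iff

theorem hierWord_eq_zero_iff {L : ℕ} (hL : 2 ≤ L) (n : ℕ) :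
    hierWord L n = 0 ↔ ¬ L ∣ n + 1 := by
  simp [hierWord_eq_iff hL]

/-- The word `ζ̃(L)`: each weight `k ≥ 1` of `ζ(L)` is replaced by `3 * M ^ (k - 1)`, where
`M = 3 * (L + 1)`, and the letters `0` are kept. -/
noncomputable def fatWord (L : ℕ) (n : ℕ) : ℕ :=
  if hierWord L n = 0 then 0 else 3 * (3 * (L + 1)) ^ (hierWord L n - 1)

/-- Number of binary digits occupied by the first `j` letters of the weighted word `ψ`, where a
letter `0` takes one digit (a zero) and a letter `k ≥ 1` takes `k` digits (a run of `k` ones). -/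
def blockStart (ψ : ℕ → ℕ) (j : ℕ) : ℕ := ∑ i ∈ Finset.range j, max 1 (ψ i)

/-- The binary sequence of a weighted word `ψ`: each letter `k ≥ 1` is replaced by a run of `k`
ones, each letter `0` by a single zero. -/
noncomputable def toBinary (ψ : ℕ → ℕ) (n : ℕ) : Bool :=
  open Classical in decide (∃ j, blockStart ψ j ≤ n ∧ n < blockStart ψ j + ψ j)

/-- The deterministic binary sequence `η(L)`. -/
noncomputable def eta (L : ℕ) : ℕ → Bool := toBinary (fatWord L)

/-- `ψ` is the run-length word of the binary sequence `ξ`: reading `ξ` from left to right, each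
maximal run of ones is recorded by its length and each zero by a letter `0`.  A letter `ψ j` that is
read from position `blockStart ψ j` on means `ψ j` ones followed by a zero. -/
def IsRunWord (ξ : ℕ → Bool) (ψ : ℕ → ℕ) : Prop :=
  ∀ j, (∀ r < ψ j, ξ (blockStart ψ j + r) = true) ∧ ξ (blockStart ψ j + ψ j) = false

theorem blockStart_succ (ψ : ℕ → ℕ) (j : ℕ) :
    blockStart ψ (j + 1) = blockStart ψ j + max 1 (ψ j) := by
  simp [blockStart, Finset.sum_range_succ]

theorem blockStart_strictMono (ψ : ℕ → ℕ) : StrictMono (blockStart ψ) :=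
  strictMono_nat_of_lt_succ fun j => by rw [blockStart_succ]; omega

theorem toBinary_zero {ψ : ℕ → ℕ} {j : ℕ} (h : ψ j = 0) :
    toBinary ψ (blockStart ψ j) = false := by
  simp only [toBinary, decide_eq_false_iff_not, not_exists, not_and, not_lt]
  intro i hi
  have hij : i ≤ j := (blockStart_strictMono ψ).le_iff_le.1 hi
  rcases hij.eq_or_lt with rfl | hlt
  · omega
  · have h1 := (blockStart_strictMono ψ).monotone (Nat.succ_le_of_lt hlt)
    rw [Nat.succ_eq_add_one, blockStart_succ] at h1
    omega

/-- A weighted word without two adjacent non-zero letters is the run-length word of its binary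
sequence. -/
theorem isRunWord_toBinary {ψ : ℕ → ℕ} (h : ∀ j, 1 ≤ ψ j → ψ (j + 1) = 0) :
    IsRunWord (toBinary ψ) ψ := by
  intro j
  refine ⟨fun r hr => ?_, ?_⟩
  · simp only [toBinary, decide_eq_true_eq]
    exact ⟨j, by omega, by omega⟩
  · rcases Nat.eq_zero_or_pos (ψ j) with h0 | h0
    · rw [h0, Nat.add_zero]
      exact toBinary_zero h0
    · have h2 := toBinary_zero (h j h0)
      rwa [blockStart_succ, max_eq_right h0] at h2

theorem fatWord_spaced {L : ℕ} (hL : 2 ≤ L) (j : ℕ) (h : 1 ≤ fatWord L j) :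
    fatWord L (j + 1) = 0 := by
  have h1 : L ∣ j + 1 := by
    by_contra hc
    rw [← hierWord_eq_zero_iff hL] at hc
    simp [fatWord, hc] at h
  have h2 : hierWord L (j + 1) = 0 := by
    rw [hierWord_eq_zero_iff hL]
    intro hc
    have h3 : L ∣ 1 := (Nat.dvd_add_right h1).1 hc
    have := Nat.le_of_dvd one_pos h3
    omega
  simp [fatWord, h2]

/-- The run-length word of `η(L)` is `ζ̃(L)`. -/
theorem isRunWord_eta {L : ℕ} (hL : 2 ≤ L) : IsRunWord (eta L) (fatWord L) :=
  isRunWord_toBinary (fatWord_spaced hL)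

/-- A binary sequence is determined by its run-length word. -/
theorem IsRunWord.unique {ψ : ℕ → ℕ} {ξ ξ' : ℕ → Bool} (h : IsRunWord ξ ψ)
    (h' : IsRunWord ξ' ψ) : ξ = ξ' := by
  have key : ∀ j n, n < blockStart ψ j → ξ n = ξ' n := by
    intro j
    induction j with
    | zero => intro n hn; simp [blockStart] at hn
    | succ j ih =>
      intro n hn
      rw [blockStart_succ] at hn
      rcases lt_or_ge n (blockStart ψ j) with hlt | hge
      · exact ih n hlt
      · obtain ⟨r, rfl⟩ := Nat.exists_eq_add_of_le hge
        rcases lt_or_ge r (ψ j) with hr | hr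
        · rw [(h j).1 r hr, (h' j).1 r hr]
        · have hr0 : r = ψ j := by omega
          rw [hr0, (h j).2, (h' j).2]
  funext n
  exact key (n + 1) n (lt_of_lt_of_le (Nat.lt_succ_self n) (blockStart_strictMono ψ).le_apply)

end BinaryCompat

/-! The argument is multiscale. Put `N = 2 * (L + 1)` and call a block of `ξ` of length `N ^ (k +
1)` good if at most one of its `N` sub-blocks of length `N ^ k` is bad; a single digit is bad if it
is a one. Bad blocks square in probability at each level, so with positive probability the first `N`
blocks of every level are all good (`bernoulliProduct_forall_not_isBad_pos`).

On that event the letters of `ζ̃(L)` are assigned consecutive intervals of `ξ`. A good block of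
level `k + 1` contains `L` consecutive good sub-blocks, so by recursion it can carry `L ^ (k + 1)`
letters (`exists_isSchedule_of_not_isBad`). Only the letter where two good blocks of level `k` meet
has to absorb leftover ones. Its index is divisible by `L ^ k`, and each side leaves at most `k * N
^ (k - 1)` ones (`ones_le_of_not_isBad`), so its weight suffices by `le_fatWord`. Such an assignment
dictates the deletions (`compatible_of_schedule`). -/

namespace BinaryCompat

/-! ### Words obtained by deleting digits from left to right -/

/-- The word `l` followed by the digits of `s` from position `a` on. -/
def prefixWord (l : List Bool) (s : ℕ → Bool) (a : ℕ) : ℕ → Bool :=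
  fun n => if n < l.length then l.getD n false else s (n - l.length + a)

theorem prefixWord_nil (s : ℕ → Bool) : prefixWord [] s 0 = s := by
  funext n
  simp [prefixWord]

theorem annihilate_prefixWord {b : Bool} {s : ℕ → Bool} {a : ℕ} (l : List Bool) (h : s a = b) :
    annihilate b l.length (prefixWord l s a) = prefixWord l s (a + 1) := by
  have h0 : prefixWord l s a l.length = b := by simp [prefixWord, h]
  rw [annihilate, if_pos h0]
  funext n
  by_cases hn : n < l.length
  · simp [prefixWord, hn, not_le.2 hn]
  · have h1 : l.length ≤ n := not_lt.1 hn
    have h2 : ¬ n + 1 < l.length := by omega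
    simp only [prefixWord, hn, h1, h2, if_true, if_false]
    congr 1
    omega

theorem prefixWord_concat (l : List Bool) (s : ℕ → Bool) (a : ℕ) :
    prefixWord (l ++ [s a]) s (a + 1) = prefixWord l s a := by
  funext n
  rcases lt_trichotomy n l.length with hn | hn | hn
  · have h1 : n < l.length + 1 := by omega
    simp [prefixWord, hn, h1]
  · subst hn
    simp [prefixWord]
  · have h1 : ¬ n < l.length + 1 := by omega
    have h2 : ¬ n < l.length := by omega
    simp only [prefixWord, h1, h2, List.length_append, List.length_singleton, if_false]
    congr 1
    omega

/-- After processing the first `a` digits of `s`, finitely many deletions of `b` have left the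
word `l` in front of the remaining digits. -/
def Processed (b : Bool) (s : ℕ → Bool) (l : List Bool) (a : ℕ) : Prop :=
  Reaches b s (prefixWord l s a)

theorem Processed.nil (b : Bool) (s : ℕ → Bool) : Processed b s [] 0 := by
  rw [Processed, prefixWord_nil]
  exact Relation.ReflTransGen.refl

theorem Processed.delete {b : Bool} {s : ℕ → Bool} {l : List Bool} {a : ℕ}
    (h : Processed b s l a) (ha : s a = b) : Processed b s l (a + 1) :=
  Relation.ReflTransGen.tail h ⟨l.length, (annihilate_prefixWord l ha).symm⟩

/-- No operator is applied: the same infinite word is split one digit later. -/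
theorem Processed.keep {b x : Bool} {s : ℕ → Bool} {l : List Bool} {a : ℕ}
    (h : Processed b s l a) (ha : s a = x) : Processed b s (l ++ [x]) (a + 1) := by
  subst ha
  rw [Processed, prefixWord_concat]
  exact h

theorem Processed.delete_run {b : Bool} {s : ℕ → Bool} {l : List Bool} {a : ℕ}
    (h : Processed b s l a) (w : ℕ) (ha : ∀ r < w, s (a + r) = b) :
    Processed b s l (a + w) := by
  induction w with
  | zero => exact h
  | succ w ih => exact (ih fun r hr => ha r (by omega)).delete (ha w (by omega))

theorem Processed.keep_run {b x : Bool} {s : ℕ → Bool} {l : List Bool} {a : ℕ}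
    (h : Processed b s l a) (w : ℕ) (ha : ∀ r < w, s (a + r) = x) :
    Processed b s (l ++ List.replicate w x) (a + w) := by
  induction w with
  | zero => simpa using h
  | succ w ih =>
    have := (ih fun r hr => ha r (by omega)).keep (ha w (by omega))
    rwa [List.append_assoc, ← List.replicate_succ'] at this

/-- A run of `w` ones can be shortened to any smaller length. -/
theorem Processed.shorten_run {s : ℕ → Bool} {l : List Bool} {a c w : ℕ}
    (h : Processed true s l a) (hcw : c ≤ w) (ha : ∀ r < w, s (a + r) = true) :
    Processed true s (l ++ List.replicate c true) (a + w) := by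
  have h1 := h.keep_run c fun r hr => ha r (by omega)
  have h2 := h1.delete_run (w - c) fun r hr => by
    rw [add_assoc]
    exact ha _ (by omega)
  rwa [add_assoc, Nat.add_sub_cancel' hcw] at h2

/-- The number of ones of `ξ` at the positions `a ≤ t < b`. -/
def ones (ξ : ℕ → Bool) (a b : ℕ) : ℕ := ((Finset.Ico a b).filter fun t => ξ t = true).card

theorem ones_self (ξ : ℕ → Bool) (a : ℕ) : ones ξ a a = 0 := by simp [ones]

theorem ones_succ {a b : ℕ} (ξ : ℕ → Bool) (h : a ≤ b) :
    ones ξ a (b + 1) = ones ξ a b + if ξ b = true then 1 else 0 := by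
  rw [ones, ones, Nat.Ico_succ_right_eq_insert_Ico h, Finset.filter_insert]
  split_ifs with hb
  · rw [Finset.card_insert_of_notMem (by simp)]
  · rfl

theorem ones_add {a b c : ℕ} (ξ : ℕ → Bool) (hab : a ≤ b) (hbc : b ≤ c) :
    ones ξ a b + ones ξ b c = ones ξ a c := by
  induction c, hbc using Nat.le_induction with
  | base => simp [ones_self]
  | succ c hc ih => rw [ones_succ ξ hc, ones_succ ξ (hab.trans hc), ← ih, add_assoc]

theorem ones_mono {a b c d : ℕ} (ξ : ℕ → Bool) (hca : c ≤ a) (hbd : b ≤ d) :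
    ones ξ a b ≤ ones ξ c d :=
  Finset.card_le_card (Finset.filter_subset_filter _ (Finset.Ico_subset_Ico hca hbd))

theorem ones_le (ξ : ℕ → Bool) (a b : ℕ) : ones ξ a b ≤ b - a :=
  (Finset.card_filter_le _ _).trans (by simp)

theorem Processed.keep_ones {ξ : ℕ → Bool} {l : List Bool} {a b : ℕ}
    (h : Processed false ξ l a) (hab : a ≤ b) :
    Processed false ξ (l ++ List.replicate (ones ξ a b) true) b := by
  induction b, hab using Nat.le_induction with
  | base => simpa [ones_self] using h
  | succ b hb ih =>
    rw [ones_succ ξ hb]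
    cases hξ : ξ b with
    | false => simpa using ih.delete hξ
    | true =>
      have := ih.keep hξ
      rw [List.append_assoc, ← List.replicate_succ'] at this
      simpa using this

/-- A letter `0` must be matched by exactly one zero, so all zeros of the interval but the last are
deleted. This is why schedules must be strictly increasing. -/
theorem Processed.keep_last_zero {ξ : ℕ → Bool} {l : List Bool} {a b : ℕ}
    (h : Processed false ξ l a) (hab : a < b) (h0 : ones ξ a b = 0) :
    Processed false ξ (l ++ [false]) b := by
  obtain ⟨b, rfl⟩ : ∃ c, b = c + 1 := ⟨b - 1, by omega⟩
  have hb : a ≤ b := by omega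
  rw [ones_succ ξ hb] at h0
  have h1 := h.keep_ones hb
  rw [show ones ξ a b = 0 by omega, List.replicate_zero, List.append_nil] at h1
  refine h1.keep ?_
  by_contra hc
  simp [hc] at h0

/-! ### Schedules -/

/-- The digits that survive when the `j`-th letter of `ψ` is read against the digits of `ξ` at the
positions `s j ≤ t < s (j + 1)`. -/
def letterDigits (ξ : ℕ → Bool) (ψ s : ℕ → ℕ) (j : ℕ) : List Bool :=
  if ψ j = 0 then [false] else List.replicate (ones ξ (s j) (s (j + 1))) true

/-- The digits that survive from the first `j` letters. -/
def commonPrefix (ξ : ℕ → Bool) (ψ s : ℕ → ℕ) : ℕ → List Bool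
  | 0 => []
  | j + 1 => commonPrefix ξ ψ s j ++ letterDigits ξ ψ s j

theorem commonPrefix_prefix (ξ : ℕ → Bool) (ψ s : ℕ → ℕ) {i j : ℕ} (h : i ≤ j) :
    commonPrefix ξ ψ s i <+: commonPrefix ξ ψ s j := by
  induction j, h using Nat.le_induction with
  | base => exact List.prefix_rfl
  | succ j _ ih => exact ih.trans (List.prefix_append _ _)

/-- A non-zero letter may leave no digit at all, but the letter after it is `0` and leaves one. -/
theorem le_length_commonPrefix (ξ : ℕ → Bool) {ψ : ℕ → ℕ} (s : ℕ → ℕ)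
    (hψ : ∀ j, 1 ≤ ψ j → ψ (j + 1) = 0) (n : ℕ) :
    n ≤ (commonPrefix ξ ψ s (2 * n)).length := by
  induction n with
  | zero => exact Nat.zero_le _
  | succ n ih =>
    rw [show 2 * (n + 1) = 2 * n + 1 + 1 by ring, commonPrefix, commonPrefix,
      List.length_append, List.length_append]
    rcases Nat.eq_zero_or_pos (ψ (2 * n)) with h0 | h0
    · have : (letterDigits ξ ψ s (2 * n)).length = 1 := by simp [letterDigits, h0]
      omega
    · have : (letterDigits ξ ψ s (2 * n + 1)).length = 1 := by simp [letterDigits, hψ _ h0]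
      omega

/-- The limit involves only `l`, not `s` or `a`; hence the words coming from `η` and from `ξ`
converge to the same sequence. -/
theorem prefixWord_tendsto {l : ℕ → List Bool} (hl : ∀ i j, i ≤ j → l i <+: l j)
    (hlen : ∀ n, n ≤ (l (2 * n)).length) (s : ℕ → Bool) (a : ℕ → ℕ) :
    Tendsto (fun k => prefixWord (l k) s (a k)) atTop
      (𝓝 fun n => (l (2 * (n + 1))).getD n false) := by
  rw [tendsto_pi_nhds]
  intro n
  refine tendsto_const_nhds.congr' ?_
  filter_upwards [eventually_ge_atTop (2 * (n + 1))] with k hk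
  have h1 : n < (l (2 * (n + 1))).length := hlen (n + 1)
  obtain ⟨m, hm⟩ := hl _ _ hk
  have h2 : n < (l k).length := by
    rw [← hm, List.length_append]
    omega
  rw [prefixWord, if_pos h2, ← hm]
  simp [List.getElem?_append_left h1]

/-- A pair is compatible if the letters of the run-length word of the first sequence can be assigned
consecutive intervals of the second one containing no more ones than the letters allow. -/
theorem compatible_of_schedule {η ξ : ℕ → Bool} {ψ s : ℕ → ℕ} (hη : IsRunWord η ψ)
    (hψ : ∀ j, 1 ≤ ψ j → ψ (j + 1) = 0) (hs : ∀ j, s j < s (j + 1))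
    (h0 : ones ξ 0 (s 0) = 0) (hones : ∀ j, ones ξ (s j) (s (j + 1)) ≤ ψ j) :
    Compatible η ξ := by
  have key : ∀ j, Processed true η (commonPrefix ξ ψ s j) (blockStart ψ j) ∧
      Processed false ξ (commonPrefix ξ ψ s j) (s j) := by
    intro j
    induction j with
    | zero =>
      refine ⟨Processed.nil _ _, ?_⟩
      simpa [h0, commonPrefix] using (Processed.nil false ξ).keep_ones (Nat.zero_le (s 0))
    | succ j ih =>
      rw [commonPrefix, blockStart_succ, letterDigits]
      split_ifs with hj
      · have := hones j
        have hz := (hη j).2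
        rw [hj, add_zero] at hz
        rw [hj]
        exact ⟨ih.1.keep hz, ih.2.keep_last_zero (hs j) (by omega)⟩
      · rw [max_eq_right (by omega)]
        exact ⟨ih.1.shorten_run (hones j) (hη j).1, ih.2.keep_ones (hs j).le⟩
  have hp := fun i j (h : i ≤ j) => commonPrefix_prefix ξ ψ s h
  have hlen := le_length_commonPrefix ξ s hψ
  exact ⟨_, _, _, fun k => (key k).1, fun k => (key k).2,
    prefixWord_tendsto hp hlen _ _, prefixWord_tendsto hp hlen _ _⟩

/-! ### Bad blocks -/

/-- The block of length `N ^ k` that starts at `t` is bad: for `k = 0` it is a one, otherwise two of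
its `N` sub-blocks are bad. -/
def IsBad (N : ℕ) (ξ : ℕ → Bool) : ℕ → ℕ → Prop
  | 0, t => ξ t = true
  | k + 1, t => ∃ i j, i < j ∧ j < N ∧ IsBad N ξ k (t + i * N ^ k) ∧ IsBad N ξ k (t + j * N ^ k)

theorem not_isBad_of_isBad {N k t i j : ℕ} {ξ : ℕ → Bool} (h : ¬ IsBad N ξ (k + 1) t)
    (hi : i < N) (hj : j < N) (hij : i ≠ j) (hb : IsBad N ξ k (t + i * N ^ k)) :
    ¬ IsBad N ξ k (t + j * N ^ k) := by
  intro hb'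
  rcases lt_or_gt_of_ne hij with hlt | hlt
  · exact h ⟨i, j, hlt, hj, hb, hb'⟩
  · exact h ⟨j, i, hlt, hi, hb', hb⟩

/-- The one possible bad sub-block costs at most its length `N ^ k`, and the good ones at most `N *
(k * N ^ (k - 1)) ≤ k * N ^ k` together. At `k = 0` the truncated exponent is harmless because of
the factor `k`. -/
theorem ones_le_of_not_isBad {N : ℕ} {ξ : ℕ → Bool} (k : ℕ) :
    ∀ t, ¬ IsBad N ξ k t → ones ξ t (t + N ^ k) ≤ k * N ^ (k - 1) := by
  classical
  induction k with
  | zero =>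
    intro t ht
    rw [IsBad] at ht
    simp [ones_succ, ones_self, ht]
  | succ k ih =>
    intro t ht
    -- Induction on the number `m` of sub-blocks read; the extra `N ^ k` is charged once, when the
    -- bad sub-block appears.
    have key : ∀ m ≤ N, ones ξ t (t + m * N ^ k) ≤ m * (k * N ^ (k - 1)) +
        if ∃ i < m, IsBad N ξ k (t + i * N ^ k) then N ^ k else 0 := by
      intro m
      induction m with
      | zero => simp [ones_self]
      | succ m ihm =>
        intro hm
        have hprev := ihm (by omega)
        have hstep : t + (m + 1) * N ^ k = t + m * N ^ k + N ^ k := by ring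
        rw [hstep, ← ones_add ξ (Nat.le_add_right t (m * N ^ k)) (Nat.le_add_right _ _)]
        by_cases hb : IsBad N ξ k (t + m * N ^ k)
        · have hnone : ¬ ∃ i < m, IsBad N ξ k (t + i * N ^ k) := by
            rintro ⟨i, him, hi⟩
            exact not_isBad_of_isBad ht (by omega) (by omega) him.ne hi hb
          rw [if_neg hnone] at hprev
          rw [if_pos ⟨m, Nat.lt_succ_self m, hb⟩]
          have := ones_le ξ (t + m * N ^ k) (t + m * N ^ k + N ^ k)
          rw [add_one_mul]
          omega
        · have hnew := ih _ hb
          have hmono : (if ∃ i < m, IsBad N ξ k (t + i * N ^ k) then N ^ k else 0) ≤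
              if ∃ i < m + 1, IsBad N ξ k (t + i * N ^ k) then N ^ k else 0 := by
            split_ifs with h1 h2
            · exact le_rfl
            · obtain ⟨i, hi, hi'⟩ := h1
              exact absurd ⟨i, by omega, hi'⟩ h2
            · exact Nat.zero_le _
            · exact le_rfl
          rw [add_one_mul]
          omega
    have h1 := key N le_rfl
    have h2 : (if ∃ i < N, IsBad N ξ k (t + i * N ^ k) then N ^ k else 0) ≤ N ^ k := by
      split_ifs <;> omega
    have h3 : N * (k * N ^ (k - 1)) ≤ k * N ^ k := by
      rcases Nat.eq_zero_or_pos k with rfl | hk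
      · simp
      · conv_rhs => rw [← Nat.sub_add_cancel hk, pow_succ]
        rw [Nat.sub_add_cancel hk]
        exact le_of_eq (by ring)
    rw [pow_succ', Nat.add_sub_cancel, add_one_mul]
    omega

/-! ### Assigning time intervals to letters -/

/-- During the time interval from `t` to `u` one passes from the letter `i` to the letter `j`; the
letter `a` is entered at time `s a`, and the ones met while at a letter `a` strictly between `i` and
`j` number at most `W a`. -/
structure IsSchedule (ξ : ℕ → Bool) (W : ℕ → ℕ) (i j t u : ℕ) (s : ℕ → ℕ) : Prop where
  mem : ∀ a, i < a → a ≤ j → t < s a ∧ s a ≤ u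
  lt : ∀ a, i < a → a < j → s a < s (a + 1)
  ones_le : ∀ a, i < a → a < j → ones ξ (s a) (s (a + 1)) ≤ W a

theorem IsSchedule.mono {ξ : ℕ → Bool} {W : ℕ → ℕ} {i j t u t' u' : ℕ} {s : ℕ → ℕ}
    (h : IsSchedule ξ W i j t u s) (ht : t' ≤ t) (hu : u ≤ u') :
    IsSchedule ξ W i j t' u' s :=
  ⟨fun a hi hj => ⟨ht.trans_lt (h.mem a hi hj).1, (h.mem a hi hj).2.trans hu⟩, h.lt, h.ones_le⟩

/-- The letter `j` at the junction is held across `u`: it absorbs the end of the first interval and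
the start of the second, at most `g` ones each. Index `0` is a fictitious start without weight. -/
theorem IsSchedule.append {ξ : ℕ → Bool} {W : ℕ → ℕ} {i j k t u v g : ℕ} {s₁ s₂ : ℕ → ℕ}
    (h₁ : IsSchedule ξ W i j t u s₁) (h₂ : IsSchedule ξ W j k u v s₂) (htu : t ≤ u)
    (huv : u ≤ v) (hg₁ : i < j → ones ξ (s₁ j) u ≤ g) (hg₂ : ones ξ u v ≤ g)
    (hW : 0 < j → 2 * g ≤ W j) :
    IsSchedule ξ W i k t v fun a => if a ≤ j then s₁ a else s₂ a := by
  refine ⟨fun a hi hk => ?_, fun a hi hk => ?_, fun a hi hk => ?_⟩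
  · split_ifs with ha
    · exact ⟨(h₁.mem a hi ha).1, (h₁.mem a hi ha).2.trans huv⟩
    · have := h₂.mem a (by omega) hk
      exact ⟨htu.trans_lt this.1, this.2⟩
  · rcases lt_trichotomy a j with ha | rfl | ha
    · simpa [ha.le, Nat.succ_le_of_lt ha] using h₁.lt a hi ha
    · have h1 := h₁.mem a hi le_rfl
      have h2 := h₂.mem (a + 1) (by omega) hk
      simp only [le_refl, if_true, Nat.not_succ_le_self, if_false]
      omega
    · have h2 : ¬ a + 1 ≤ j := by omega
      simpa [ha.not_ge, h2] using h₂.lt a ha hk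
  · rcases lt_trichotomy a j with ha | rfl | ha
    · simpa [ha.le, Nat.succ_le_of_lt ha] using h₁.ones_le a hi ha
    · have h1 := h₁.mem a hi le_rfl
      have h2 := h₂.mem (a + 1) (by omega) hk
      simp only [le_refl, if_true, Nat.not_succ_le_self, if_false]
      rw [← ones_add ξ h1.2 h2.1.le]
      have h3 := hg₁ hi
      have h5 := hW (by omega)
      have h4 := ones_mono ξ (le_refl u) h2.2
      omega
    · have h2 : ¬ a + 1 ≤ j := by omega
      simpa [ha.not_ge, h2] using h₂.ones_le a ha hk

section Crossing

variable {ξ : ℕ → Bool} {W : ℕ → ℕ} {L N : ℕ}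

/-- A schedule can be prolonged over consecutive good blocks, one letter of level `k` being passed
in each of them. -/
theorem IsSchedule.extend {k i₀ i t₀ t : ℕ} {s₀ : ℕ → ℕ} (hL : 0 < L)
    (hW : ∀ a, 0 < a → L ^ k ∣ a → 2 * (k * N ^ (k - 1)) ≤ W a)
    (hk : ∀ t i, ¬ IsBad N ξ k t → L ^ k ∣ i →
      ∃ s, IsSchedule ξ W i (i + L ^ k) t (t + N ^ k) s)
    (h₀ : IsSchedule ξ W i₀ i t₀ t s₀) (hi : L ^ k ∣ i) (htt : t₀ ≤ t)
    (hones : i₀ < i → ones ξ (s₀ i) t ≤ k * N ^ (k - 1)) (m : ℕ)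
    (hm : ∀ r < m, ¬ IsBad N ξ k (t + r * N ^ k)) :
    ∃ s, IsSchedule ξ W i₀ (i + m * L ^ k) t₀ (t + m * N ^ k) s ∧ (∀ a ≤ i, s a = s₀ a) ∧
      (i₀ < i + m * L ^ k → ones ξ (s (i + m * L ^ k)) (t + m * N ^ k) ≤ k * N ^ (k - 1)) := by
  induction m with
  | zero => exact ⟨s₀, by simpa using h₀, fun _ _ => rfl, by simpa using hones⟩
  | succ m ih =>
    obtain ⟨s₁, hs₁, heq, hend⟩ := ih fun r hr => hm r (by omega)
    have hgood := hm m (Nat.lt_succ_self m)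
    have hdvd : L ^ k ∣ i + m * L ^ k := dvd_add hi (dvd_mul_left _ _)
    obtain ⟨s₂, hs₂⟩ := hk _ _ hgood hdvd
    have hg := ones_le_of_not_isBad k _ hgood
    have hpos : 0 < L ^ k := Nat.pow_pos hL
    have hcat := hs₁.append hs₂ (by omega) (Nat.le_add_right _ _) hend hg
      fun h => hW _ h hdvd
    rw [add_one_mul, add_one_mul, ← add_assoc, ← add_assoc]
    refine ⟨_, hcat, fun a ha => ?_, fun _ => ?_⟩
    · rw [if_pos (by omega), heq a ha]
    · rw [if_neg (by omega)]
      exact (ones_mono ξ (hs₂.mem _ (by omega) le_rfl).1.le le_rfl).trans hg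

/-- During a good block of level `k` one can pass from a letter of level at least `k` to the
next one. -/
theorem exists_isSchedule_of_not_isBad (hL : 0 < L) (hN : 2 * L ≤ N)
    (hW : ∀ k a, 0 < a → L ^ k ∣ a → 2 * (k * N ^ (k - 1)) ≤ W a) (k : ℕ) :
    ∀ t i, ¬ IsBad N ξ k t → L ^ k ∣ i →
      ∃ s, IsSchedule ξ W i (i + L ^ k) t (t + N ^ k) s := by
  induction k with
  | zero =>
    intro t i _ _
    rw [pow_zero, pow_zero]
    refine ⟨fun _ => t + 1, fun a _ _ => ⟨by omega, by omega⟩, fun a _ _ => by omega,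
      fun a _ _ => by omega⟩
  | succ k ih =>
    intro t i ht hi
    -- If one of the first `L` sub-blocks is bad, the `L` that follow it are good; otherwise the
    -- first `L` serve.
    obtain ⟨c, hc, hgood⟩ : ∃ c, c + L ≤ N ∧
        ∀ r < L, ¬ IsBad N ξ k (t + c * N ^ k + r * N ^ k) := by
      by_cases h : ∃ r < L, IsBad N ξ k (t + r * N ^ k)
      · obtain ⟨r₀, hr₀, hb⟩ := h
        refine ⟨r₀ + 1, by omega, fun r hr => ?_⟩
        rw [add_assoc, ← add_mul]
        exact not_isBad_of_isBad ht (by omega) (by omega) (by omega) hb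
      · push Not at h
        exact ⟨0, by omega, by simpa using h⟩
    -- The empty schedule, in which `id` is a dummy. Ones before the chosen run are left to
    -- whichever letter is held at `i`.
    have htriv : IsSchedule ξ W i i (t + c * N ^ k) (t + c * N ^ k) id :=
      ⟨fun a _ _ => by omega, fun a _ _ => by omega, fun a _ _ => by omega⟩
    obtain ⟨s, hs, -⟩ := htriv.extend hL (hW k) ih ((pow_dvd_pow L k.le_succ).trans hi) le_rfl
      (fun h => absurd h (lt_irrefl i)) L hgood
    refine ⟨s, ?_⟩
    rw [pow_succ' L, pow_succ' N]
    refine hs.mono (Nat.le_add_right _ _) ?_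
    rw [add_assoc, ← add_mul]
    exact Nat.add_le_add_left (Nat.mul_le_mul_right _ hc) _

/-- If all initial blocks are good, there is a schedule for the whole word; `s a` is the time at
which the `a`-th letter is entered, and the first letter is entered at time one. -/
theorem exists_schedule (hL : 2 ≤ L) (hN : 2 * L ≤ N)
    (hW : ∀ k a, 0 < a → L ^ k ∣ a → 2 * (k * N ^ (k - 1)) ≤ W a)
    (hgood : ∀ k, ∀ i < N, ¬ IsBad N ξ k (i * N ^ k)) :
    ∃ s : ℕ → ℕ, s 1 = 1 ∧ ∀ a, 0 < a → s a < s (a + 1) ∧ ones ξ (s a) (s (a + 1)) ≤ W a := by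
  have hL0 : 0 < L := by omega
  let P : ℕ → (ℕ → ℕ) → Prop := fun k s => IsSchedule ξ W 0 (L ^ k) 0 (N ^ k) s ∧ s 1 = 1
  have hstep : ∀ k s, P k s → ∃ s', P (k + 1) s' ∧ ∀ a ≤ L ^ k, s' a = s a := by
    intro k s ⟨hs, hs1⟩
    have hpos : 0 < L ^ k := Nat.pow_pos hL0
    have hblock : ¬ IsBad N ξ k 0 := by simpa using hgood k 0 (by omega)
    have hend : ones ξ (s (L ^ k)) (N ^ k) ≤ k * N ^ (k - 1) := by
      have h1 := ones_le_of_not_isBad k 0 hblock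
      rw [zero_add] at h1
      exact (ones_mono ξ (Nat.zero_le _) le_rfl).trans h1
    -- The level-`k` blocks numbered `1` to `L - 1` lead from letter `L ^ k` to letter `L ^ (k +
    -- 1)`.
    obtain ⟨s', hs', heq, -⟩ := hs.extend hL0 (hW k)
      (exists_isSchedule_of_not_isBad hL0 hN hW k) dvd_rfl (Nat.zero_le _) (fun _ => hend) (L - 1)
      (fun r hr => by
        have := hgood k (r + 1) (by omega)
        rwa [add_one_mul, add_comm] at this)
    have e1 : L ^ k + (L - 1) * L ^ k = L ^ (k + 1) := by
      rw [pow_succ', ← one_add_mul, Nat.add_sub_cancel' (by omega)]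
    have e2 : N ^ k + (L - 1) * N ^ k ≤ N ^ (k + 1) := by
      rw [pow_succ', ← one_add_mul]
      exact Nat.mul_le_mul_right _ (by omega)
    rw [e1] at hs'
    exact ⟨s', ⟨hs'.mono le_rfl e2, (heq 1 hpos).trans hs1⟩, heq⟩
  have hbase : P 0 fun _ => 1 := by
    refine ⟨⟨fun a _ _ => ?_, fun a h1 h2 => ?_, fun a h1 h2 => ?_⟩, rfl⟩
    · simp
    all_goals
      rw [pow_zero] at h2
      omega
  choose! next hnext hagree using hstep
  let S : ℕ → ℕ → ℕ := fun k => Nat.rec (fun _ => 1) next k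
  have hS : ∀ k, P k (S k) := by
    intro k
    induction k with
    | zero => exact hbase
    | succ k ih => exact hnext k _ ih
  have hSS : ∀ j k, j ≤ k → ∀ a ≤ L ^ j, S k a = S j a := by
    intro j k hjk
    induction k, hjk using Nat.le_induction with
    | base => exact fun _ _ => rfl
    | succ k hjk ih =>
      intro a ha
      rw [← ih a ha]
      exact hagree k _ (hS k) a (ha.trans (Nat.pow_le_pow_right hL0 hjk))
  -- Since `a < L ^ a`, the entry time of letter `a` no longer changes after stage `a`.
  refine ⟨fun a => S a a, (hS 1).2, fun a ha => ?_⟩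
  have h1 : a < L ^ a := Nat.lt_pow_self (by omega)
  have h2 : a < L ^ (a + 1) := h1.trans (Nat.pow_lt_pow_right (by omega) a.lt_succ_self)
  have h3 : S a a = S (a + 1) a := (hSS a (a + 1) a.le_succ a h1.le).symm
  simp only [h3]
  exact ⟨(hS (a + 1)).1.lt a ha h2, (hS (a + 1)).1.ones_le a ha h2⟩

end Crossing

/-! ### The letters of `η(L)` -/

theorem mul_two_pow_le_three_pow (k : ℕ) : k * 2 ^ k ≤ 3 ^ k := by
  induction k with
  | zero => simp
  | succ k ih =>
    -- The inductive step needs `2 * (k + 1) ≤ 3 * k`, hence `k ≥ 2`.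
    rcases k with _ | _ | k
    · norm_num
    · norm_num
    · rw [pow_succ 2, pow_succ 3]
      nlinarith [Nat.pow_pos (n := k + 2) (show 0 < 2 by norm_num)]

/-- For `k ≥ 1` the left side is `k * 2 ^ k * (L + 1) ^ (k - 1)`, and `k * 2 ^ k ≤ 3 ^ k` turns it
into at most `3 * M ^ (k - 1)`. -/
theorem le_fatWord {L : ℕ} (hL : 2 ≤ L) {k j : ℕ} (h : L ^ k ∣ j + 1) :
    2 * (k * (2 * (L + 1)) ^ (k - 1)) ≤ fatWord L j := by
  rcases k with _ | k
  · simp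
  have hm := (hierWord_eq_iff hL j (hierWord L j)).1 rfl
  have hk : k + 1 ≤ hierWord L j := by
    by_contra hc
    exact hm.2 ((pow_dvd_pow L (by omega)).trans h)
  rw [fatWord, if_neg (by omega), Nat.add_sub_cancel]
  calc 2 * ((k + 1) * (2 * (L + 1)) ^ k)
      = ((k + 1) * 2 ^ (k + 1)) * (L + 1) ^ k := by rw [mul_pow]; ring
    _ ≤ 3 ^ (k + 1) * (L + 1) ^ k := Nat.mul_le_mul_right _ (mul_two_pow_le_three_pow _)
    _ = 3 * (3 * (L + 1)) ^ k := by rw [mul_pow]; ring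
    _ ≤ 3 * (3 * (L + 1)) ^ (hierWord L j - 1) :=
      Nat.mul_le_mul_left _ (Nat.pow_le_pow_right (by omega) (by omega))

theorem compatible_eta_of_not_isBad {L : ℕ} (hL : 2 ≤ L) {ξ : ℕ → Bool}
    (hgood : ∀ k, ∀ i < 2 * (L + 1), ¬ IsBad (2 * (L + 1)) ξ k (i * (2 * (L + 1)) ^ k)) :
    Compatible (eta L) ξ := by
  -- Schedules number letters from one, so that levels are read off from divisibility of the index.
  obtain ⟨s, hs1, hs⟩ := exists_schedule (W := fun a => fatWord L (a - 1)) hL (by omega)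
    (fun k a ha hk => le_fatWord hL (by rwa [Nat.sub_add_cancel ha])) hgood
  have h0 : ¬ IsBad (2 * (L + 1)) ξ 0 0 := by simpa using hgood 0 0 (by omega)
  refine compatible_of_schedule (s := fun j => s (j + 1)) (isRunWord_eta hL) (fatWord_spaced hL)
    (fun j => (hs _ j.succ_pos).1) ?_ fun j => (hs _ j.succ_pos).2
  rw [IsBad] at h0
  simp only [zero_add, hs1]
  simp [ones, h0]

/-! ### The probability of bad blocks -/

instance (p : unitInterval) : IsProbabilityMeasure (bernoulliProduct p) := by
  unfold bernoulliProduct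
  infer_instance

theorem bernoulliProduct_real_apply_true (p : unitInterval) (t : ℕ) :
    (bernoulliProduct p).real {ξ | ξ t = true} = p := by
  have h := measurePreserving_eval_infinitePi (fun _ : ℕ => bernoulliMeasure true false p) t
  have h1 := h.measureReal_preimage (s := ({true} : Set Bool))
    (measurableSet_singleton _).nullMeasurableSet
  have h2 : (Function.eval t : (ℕ → Bool) → Bool) ⁻¹' {true} = {ξ | ξ t = true} := rfl
  rw [h2] at h1
  rw [bernoulliProduct, h1, bernoulliMeasure_real_apply _ (measurableSet_singleton _)]
  simp

/-- Two events that depend on disjoint finite sets of digits are independent. -/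
theorem bernoulliProduct_real_inter (p : unitInterval) {S T : Finset ℕ} (hST : Disjoint S T)
    {A B : Set (ℕ → Bool)} (hA : DependsOn (· ∈ A) (S : Set ℕ))
    (hB : DependsOn (· ∈ B) (T : Set ℕ)) :
    (bernoulliProduct p).real (A ∩ B) =
      (bernoulliProduct p).real A * (bernoulliProduct p).real B := by
  have hind : iIndepFun (fun (i : ℕ) (ξ : ℕ → Bool) => ξ i) (bernoulliProduct p) :=
    iIndepFun_infinitePi (X := fun _ x => x) fun _ => measurable_id
  have hpre : ∀ {R : Finset ℕ} {C : Set (ℕ → Bool)}, DependsOn (· ∈ C) (R : Set ℕ) →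
      (fun (ξ : ℕ → Bool) (i : R) => ξ i) ⁻¹' ((fun (ξ : ℕ → Bool) (i : R) => ξ i) '' C) = C := by
    intro R C hC
    refine Set.Subset.antisymm ?_ (Set.subset_preimage_image _ _)
    rintro ξ ⟨ξ', hξ', heq⟩
    exact (hC fun i hi => congrFun heq ⟨i, hi⟩).mp hξ'
  have h := (hind.indepFun_finset S T hST
    fun i => measurable_pi_apply i).measure_inter_preimage_eq_mul (s := (fun (ξ : ℕ → Bool) (i : S) => ξ i) '' A)
    (t := (fun (ξ : ℕ → Bool) (i : T) => ξ i) '' B) (Set.toFinite _).measurableSet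
    (Set.toFinite _).measurableSet
  rw [hpre hA, hpre hB] at h
  rw [measureReal_def, h, ENNReal.toReal_mul, measureReal_def, measureReal_def]

theorem isBad_congr {N : ℕ} {ξ ξ' : ℕ → Bool} (k : ℕ) :
    ∀ t, (∀ r ∈ Finset.Ico t (t + N ^ k), ξ r = ξ' r) → (IsBad N ξ k t ↔ IsBad N ξ' k t) := by
  induction k with
  | zero =>
    intro t h
    rw [IsBad, IsBad, h t (by simp)]
  | succ k ih =>
    intro t h
    have hsub : ∀ i < N, (IsBad N ξ k (t + i * N ^ k) ↔ IsBad N ξ' k (t + i * N ^ k)) := by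
      intro i hi
      refine ih _ fun r hr => h r ?_
      have h1 : (i + 1) * N ^ k ≤ N * N ^ k := Nat.mul_le_mul_right _ hi
      rw [Finset.mem_Ico] at hr ⊢
      rw [pow_succ']
      rw [add_one_mul] at h1
      omega
    rw [IsBad, IsBad]
    refine exists_congr fun i => exists_congr fun j => and_congr_right fun hij =>
      and_congr_right fun hj => ?_
    rw [hsub i (by omega), hsub j hj]

/-- Union bound over at most `N ^ 2` pairs of disjoint, hence independent, sub-blocks. -/
theorem bernoulliProduct_real_isBad_succ_le (p : unitInterval) {N k : ℕ} {q : ℝ}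
    (hq : ∀ t, (bernoulliProduct p).real {ξ | IsBad N ξ k t} ≤ q) (t : ℕ) :
    (bernoulliProduct p).real {ξ | IsBad N ξ (k + 1) t} ≤ (N * q) ^ 2 := by
  have hq0 : 0 ≤ q := measureReal_nonneg.trans (hq 0)
  let I : Finset (ℕ × ℕ) := (Finset.range N ×ˢ Finset.range N).filter fun x => x.1 < x.2
  have hcover : {ξ | IsBad N ξ (k + 1) t} ⊆ ⋃ x ∈ I,
      {ξ | IsBad N ξ k (t + x.1 * N ^ k)} ∩ {ξ | IsBad N ξ k (t + x.2 * N ^ k)} := by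
    rintro ξ ⟨i, j, hij, hj, hi', hj'⟩
    simp only [Set.mem_iUnion]
    exact ⟨(i, j), by simp [I]; omega, hi', hj'⟩
  have hdep : ∀ u, DependsOn (· ∈ {ξ : ℕ → Bool | IsBad N ξ k u})
      (Finset.Ico u (u + N ^ k) : Set ℕ) :=
    fun u ξ ξ' h => propext (isBad_congr k u fun r hr => h r (by simpa using hr))
  have hpair : ∀ x ∈ I, (bernoulliProduct p).real
      ({ξ | IsBad N ξ k (t + x.1 * N ^ k)} ∩ {ξ | IsBad N ξ k (t + x.2 * N ^ k)}) ≤ q ^ 2 := by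
    intro x hx
    have hlt : x.1 < x.2 := (Finset.mem_filter.1 hx).2
    have hdisj : Disjoint (Finset.Ico (t + x.1 * N ^ k) (t + x.1 * N ^ k + N ^ k))
        (Finset.Ico (t + x.2 * N ^ k) (t + x.2 * N ^ k + N ^ k)) := by
      have h1 : (x.1 + 1) * N ^ k ≤ x.2 * N ^ k := Nat.mul_le_mul_right _ hlt
      rw [add_one_mul] at h1
      exact Finset.Ico_disjoint_Ico_consecutive _ _ _ |>.mono_right
        (Finset.Ico_subset_Ico (by omega) le_rfl)
    rw [bernoulliProduct_real_inter p hdisj (by simpa using hdep _) (by simpa using hdep _), sq]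
    exact mul_le_mul (hq _) (hq _) measureReal_nonneg hq0
  have hcard : (I.card : ℝ) ≤ (N : ℝ) ^ 2 := by
    have h1 : I.card ≤ N * N := (Finset.card_filter_le _ _).trans (by simp)
    rw [sq]
    exact_mod_cast h1
  calc (bernoulliProduct p).real {ξ | IsBad N ξ (k + 1) t}
      ≤ (bernoulliProduct p).real _ := measureReal_mono hcover (measure_ne_top _ _)
    _ ≤ ∑ x ∈ I, (bernoulliProduct p).real _ := measureReal_biUnion_finset_le _ _
    _ ≤ ∑ x ∈ I, q ^ 2 := Finset.sum_le_sum hpair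
    _ = I.card * q ^ 2 := by rw [Finset.sum_const, nsmul_eq_mul]
    _ ≤ N ^ 2 * q ^ 2 := mul_le_mul_of_nonneg_right hcard (sq_nonneg q)
    _ = (N * q) ^ 2 := (mul_pow _ _ _).symm

/-- With `q` bounding the probability at one level, `N ^ 2 * q` is squared at the next. Starting
from `1 / 4`, only the geometric part of this decay is kept. -/
theorem bernoulliProduct_real_isBad_le (p : unitInterval) {N : ℕ} (hN : 0 < N)
    (hp : (p : ℝ) ≤ (1 / 4) / N ^ 2) (k t : ℕ) :
    (bernoulliProduct p).real {ξ | IsBad N ξ k t} ≤ (1 / 4) ^ (k + 1) / N ^ 2 := by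
  have hN' : (0 : ℝ) < N := by exact_mod_cast hN
  induction k generalizing t with
  | zero =>
    simp only [IsBad, bernoulliProduct_real_apply_true]
    simpa using hp
  | succ k ih =>
    refine (bernoulliProduct_real_isBad_succ_le p ih t).trans ?_
    have h1 : ((N : ℝ) * ((1 / 4) ^ (k + 1) / N ^ 2)) ^ 2 =
        ((1 / 4 : ℝ) ^ (k + 1) * (1 / 4) ^ (k + 1)) / N ^ 2 := by
      field_simp
    rw [h1, pow_succ _ (k + 1)]
    have h2 : (1 / 4 : ℝ) ^ (k + 1) ≤ 1 / 4 :=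
      pow_le_of_le_one (by norm_num) (by norm_num) k.succ_ne_zero
    gcongr

/-- With positive probability the first `N` blocks of every level are good. -/
theorem bernoulliProduct_forall_not_isBad_pos (p : unitInterval) {N : ℕ} (hN : 0 < N)
    (hp : (p : ℝ) ≤ (1 / 4) / N ^ 2) :
    0 < bernoulliProduct p {ξ | ∀ k, ∀ i < N, ¬ IsBad N ξ k (i * N ^ k)} := by
  have hN' : (1 : ℝ) ≤ N := by exact_mod_cast hN
  set B : Set (ℕ → Bool) := {ξ | ∀ k, ∀ i < N, ¬ IsBad N ξ k (i * N ^ k)}ᶜ with hB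
  have hcover : B ⊆ ⋃ k, ⋃ i ∈ Finset.range N, {ξ | IsBad N ξ k (i * N ^ k)} := by
    intro ξ hξ
    simp only [hB, Set.mem_compl_iff, Set.mem_ofPred_eq, not_forall, not_not] at hξ
    obtain ⟨k, i, hi, hb⟩ := hξ
    simp only [Set.mem_iUnion]
    exact ⟨k, i, by simpa using hi, hb⟩
  have hlevel : ∀ k, bernoulliProduct p (⋃ i ∈ Finset.range N, {ξ | IsBad N ξ k (i * N ^ k)}) ≤
      ENNReal.ofReal ((1 / 4) * (1 / 4) ^ k) := by
    intro k
    rw [← ofReal_measureReal (measure_ne_top _ _)]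
    refine ENNReal.ofReal_le_ofReal ?_
    calc (bernoulliProduct p).real _
        ≤ ∑ i ∈ Finset.range N, (bernoulliProduct p).real {ξ | IsBad N ξ k (i * N ^ k)} :=
          measureReal_biUnion_finset_le _ _
      _ ≤ ∑ i ∈ Finset.range N, (1 / 4 : ℝ) ^ (k + 1) / N ^ 2 :=
          Finset.sum_le_sum fun i _ => bernoulliProduct_real_isBad_le p hN hp k _
      _ = (1 / 4 : ℝ) ^ (k + 1) / N := by
          rw [Finset.sum_const, Finset.card_range, nsmul_eq_mul]
          field_simp
      _ ≤ (1 / 4 : ℝ) ^ (k + 1) := div_le_self (by positivity) hN'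
      _ = 1 / 4 * (1 / 4) ^ k := pow_succ' _ _
  have hgeom : Summable fun k : ℕ => (1 / 4 : ℝ) * (1 / 4) ^ k :=
    (summable_geometric_of_lt_one (by norm_num) (by norm_num)).mul_left _
  have hBlt : bernoulliProduct p B < 1 := by
    calc bernoulliProduct p B
        ≤ ∑' k, ENNReal.ofReal ((1 / 4) * (1 / 4) ^ k) :=
          (measure_mono hcover).trans ((measure_iUnion_le _).trans (ENNReal.tsum_le_tsum hlevel))
      _ = ENNReal.ofReal (1 / 3) := by
          rw [← ENNReal.ofReal_tsum_of_nonneg (fun k => by positivity) hgeom, tsum_mul_left,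
            tsum_geometric_of_lt_one (by norm_num) (by norm_num)]
          norm_num
      _ < 1 := by
          rw [← ENNReal.ofReal_one]
          exact (ENNReal.ofReal_lt_ofReal_iff one_pos).2 (by norm_num)
  rw [pos_iff_ne_zero]
  intro h0
  -- Subadditivity suffices, so measurability of `B` is not needed.
  have h1 := measure_union_le (μ := bernoulliProduct p) Bᶜ B
  rw [Set.compl_union_self, measure_univ, hB, compl_compl, h0, zero_add] at h1
  exact absurd h1 (not_le.2 hBlt)

end BinaryCompat

theorem mainTheorem2 (L : ℕ) (hL : 2 ≤ L) (p : unitInterval)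
    (hp : (p : ℝ) < 1 / (576 * ((L : ℝ) + 1) ^ 2)) :
    0 < BinaryCompat.bernoulliProduct p {ξ : ℕ → Bool | BinaryCompat.Compatible (BinaryCompat.eta L) ξ} := by
  -- The method only needs `p ≤ 1 / (16 * (L + 1) ^ 2)`, which is `1 / (4 * N ^ 2)`.
  have hp' : (p : ℝ) ≤ (1 / 4) / ((2 * (L + 1) : ℕ) : ℝ) ^ 2 := by
    refine hp.le.trans ?_
    push_cast
    rw [div_div]
    refine one_div_le_one_div_of_le (by positivity) ?_
    nlinarith [sq_nonneg ((L : ℝ) + 1)]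
  exact (BinaryCompat.bernoulliProduct_forall_not_isBad_pos p (by omega) hp').trans_le
    (measure_mono fun _ hξ => BinaryCompat.compatible_eta_of_not_isBad hL hξ)
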